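/- Let $X$ and $Y$ be infinite-dimensional (real or complex) Banach spaces and let $T: X\to Y$ be a continuous linear surjection. Then there exist a constant $\eta>0$ and a map $\tau: Y\to X$ such that - $\tau$ is continuous and positively homogeneous, i.e. $\tau(ty)=t\,\tau(y)$ for all $y\in Y$ and all real $t\ge 0$; - $\tau$ is a right inverse of $T$, i.e. $T(\tau(y))=y$ for all $y\in Y$; - $\tau$ is pointwise $\eta$-Lipschitz on a dense meager subset of $Y$, i.e. there is a dense and meager set $S\subseteq Y$ such that for every $b\in S$ $$\limsup_{r\to 0^+}\left(r^{-1}\sup\{\|\tau(b)-\tau(a)\| : a\in Y,\ \|a-b\|\le r\}\right)\le\eta .$$ -/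

import Mathlib

open Filter Topology
open scoped NNReal ENNReal

/-- A map `f` between metric spaces is pointwise `α`-Lipschitz at `b` if
`limsup_{r → 0+} (r⁻¹ * sup {d(f(b), f(a)) | a in the closed ball of radius r about b}) ≤ α`.
The supremum and the limsup are taken in `[0, ∞]`, so an unbounded set has supremum `∞`. -/
def PointwiseLipschitzAt {M M' : Type*} [MetricSpace M] [MetricSpace M']
    (α : ℝ≥0) (f : M → M') (b : M) : Prop :=
  limsup (fun r : ℝ => (ENNReal.ofReal r)⁻¹ * ⨆ a ∈ Metric.closedBall b r, edist (f b) (f a))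
    (𝓝[>] (0 : ℝ)) ≤ (α : ℝ≥0∞)

/-- `f` is pointwise `α`-Lipschitz on `S` if it is pointwise `α`-Lipschitz, as a map on the whole
space, at every point of `S`. -/
def PointwiseLipschitzOn {M M' : Type*} [MetricSpace M] [MetricSpace M']
    (α : ℝ≥0) (f : M → M') (S : Set M) : Prop :=
  ∀ b ∈ S, PointwiseLipschitzAt α f b

/-- `f (t • y) = t • f y` for all real `t ≥ 0`, where real numbers act through the inclusion of
`ℝ` in the scalar field `𝕜`. -/
def PositivelyHomogeneous (𝕜 : Type*) [RCLike 𝕜] {Y X : Type*}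
    [NormedAddCommGroup Y] [NormedSpace 𝕜 Y] [NormedAddCommGroup X] [NormedSpace 𝕜 X]
    (f : Y → X) : Prop :=
  ∀ t : ℝ, 0 ≤ t → ∀ y : Y, f ((t : 𝕜) • y) = (t : 𝕜) • f y

/-! Bartle–Graves gives a continuous right inverse `τ₀` with `‖τ₀ y‖ ≤ K * ‖y‖`, which is therefore
pointwise Lipschitz at `0`. Each translate `y ↦ τ d + τ₀ (y - d)` of it is again a right inverse,
now controlled at `d`. Since right inverses may be averaged with continuous weights, any right
inverse `τ` can be replaced near a separated set of points `d` by such translates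
(`exists_rightInverse_eq_translate`).

This is repeated over finer and finer nets of the unit sphere, with corrections that are summable
and also bounded by a summable multiple of the distance to earlier net points. The limit is then
continuous and keeps the pointwise bound at every net point
(`exists_rightInverse_eventually_dist_le`). Radial extension makes it homogeneous, which spreads the
bound to all positive rational multiples of the nets: a dense set, and a countable union of
separated, hence nowhere dense, sets. -/

/-- The positively homogeneous extension of the restriction of `f` to the unit sphere. -/
noncomputable def sphereExtend {E F : Type*} [NormedAddCommGroup E] [NormedSpace ℝ E]
    [NormedAddCommGroup F] [NormedSpace ℝ F] (f : F → E) (y : F) : E :=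
  ‖y‖ • f (‖y‖⁻¹ • y)

section Real

variable {E F : Type*} [NormedAddCommGroup E] [NormedSpace ℝ E]
  [NormedAddCommGroup F] [NormedSpace ℝ F]

/-! ### Radial extension from the unit sphere -/

lemma norm_inv_norm_smul_self {y : F} (hy : y ≠ 0) : ‖‖y‖⁻¹ • y‖ = 1 := by
  rw [norm_smul, norm_inv, norm_norm, inv_mul_cancel₀ (norm_ne_zero_iff.2 hy)]

lemma norm_sphereExtend_le {f : F → E} {K : ℝ} (hf : ∀ y, ‖y‖ = 1 → ‖f y‖ ≤ K) (y : F) :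
    ‖sphereExtend f y‖ ≤ K * ‖y‖ := by
  rcases eq_or_ne y 0 with rfl | hy
  · simp [sphereExtend]
  · rw [sphereExtend, norm_smul, norm_norm, mul_comm]
    exact mul_le_mul_of_nonneg_right (hf _ (norm_inv_norm_smul_self hy)) (norm_nonneg _)

lemma continuous_sphereExtend {f : F → E} {K : ℝ} (hf : Continuous f)
    (hK : ∀ y, ‖y‖ = 1 → ‖f y‖ ≤ K) : Continuous (sphereExtend f) := by
  rw [continuous_iff_continuousAt]
  intro y
  rcases eq_or_ne y 0 with rfl | hy
  · have h0 : sphereExtend f 0 = 0 := by simp [sphereExtend]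
    rw [ContinuousAt, h0]
    refine squeeze_zero_norm (norm_sphereExtend_le hK) ?_
    have : Continuous fun y : F => K * ‖y‖ := by fun_prop
    simpa using this.tendsto 0
  · have h1 : ContinuousAt (fun y : F => ‖y‖⁻¹ • y) y :=
      (continuous_norm.continuousAt.inv₀ (norm_ne_zero_iff.2 hy)).smul continuousAt_id
    exact continuous_norm.continuousAt.smul (hf.continuousAt.comp h1)

lemma sphereExtend_smul (f : F → E) {t : ℝ} (ht : 0 ≤ t) (y : F) :
    sphereExtend f (t • y) = t • sphereExtend f y := by
  rcases ht.eq_or_lt with rfl | ht'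
  · simp [sphereExtend]
  · have : (‖t • y‖⁻¹ • t • y) = ‖y‖⁻¹ • y := by
      rw [norm_smul, Real.norm_of_nonneg ht, smul_smul, mul_inv, mul_right_comm,
        inv_mul_cancel₀ ht'.ne', one_mul]
    rw [sphereExtend, this, norm_smul, Real.norm_of_nonneg ht, mul_smul, sphereExtend]

lemma map_sphereExtend (T : E →L[ℝ] F) {f : F → E} (hf : ∀ y, T (f y) = y) (y : F) :
    T (sphereExtend f y) = y := by
  rcases eq_or_ne y 0 with rfl | hy
  · simp [sphereExtend]
  · rw [sphereExtend, map_smul, hf, smul_smul, mul_inv_cancel₀ (norm_ne_zero_iff.2 hy), one_smul]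

lemma dist_inv_norm_smul_le {d : F} (hd : ‖d‖ = 1) (y : F) :
    dist (‖y‖⁻¹ • y) d ≤ 2 * dist y d := by
  rcases eq_or_ne y 0 with rfl | hy
  · simp [hd]
  have h1 : dist (‖y‖⁻¹ • y) y ≤ dist y d := by
    have h2 : ‖y‖⁻¹ • y - y = (1 - ‖y‖) • (‖y‖⁻¹ • y) := by
      rw [sub_smul, one_smul, smul_smul, mul_inv_cancel₀ (norm_ne_zero_iff.2 hy), one_smul]
    rw [dist_eq_norm, h2, norm_smul, norm_inv_norm_smul_self hy, mul_one, dist_eq_norm, ← hd,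
      norm_sub_rev y d]
    exact abs_norm_sub_norm_le d y
  linarith [dist_triangle (‖y‖⁻¹ • y) y d]

/-- A pointwise Lipschitz bound at a unit vector passes to the homogeneous extension. -/
lemma eventually_dist_sphereExtend_le {f : F → E} {K L : ℝ} (hL : 0 ≤ L)
    (hK : ∀ y, ‖y‖ = 1 → ‖f y‖ ≤ K) {d : F} (hd : ‖d‖ = 1)
    (h : ∀ᶠ y in 𝓝 d, dist (f y) (f d) ≤ L * dist y d) :
    ∀ᶠ y in 𝓝 d, dist (sphereExtend f y) (sphereExtend f d) ≤ (K + 2 * L) * dist y d := by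
  have hd0 : d ≠ 0 := by rintro rfl; simp at hd
  have hc : Tendsto (fun y : F => ‖y‖⁻¹ • y) (𝓝 d) (𝓝 d) := by
    rw [tendsto_iff_dist_tendsto_zero]
    refine squeeze_zero (fun _ => dist_nonneg) (dist_inv_norm_smul_le hd) ?_
    have : Continuous fun y : F => 2 * dist y d := by fun_prop
    simpa using this.tendsto d
  filter_upwards [hc.eventually h, isOpen_ne.mem_nhds hd0] with y hy hy0
  have hfd : sphereExtend f d = f d := by simp [sphereExtend, hd]
  have h1 : dist (sphereExtend f y) (f (‖y‖⁻¹ • y)) ≤ K * dist y d := by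
    have h2 : sphereExtend f y - f (‖y‖⁻¹ • y) = (‖y‖ - 1) • f (‖y‖⁻¹ • y) := by
      rw [sphereExtend, sub_smul, one_smul]
    rw [dist_eq_norm, h2, norm_smul, dist_eq_norm, mul_comm, ← hd]
    exact mul_le_mul (hK _ (norm_inv_norm_smul_self hy0)) (abs_norm_sub_norm_le y d)
      (norm_nonneg _) ((norm_nonneg _).trans (hK _ (norm_inv_norm_smul_self hy0)))
  have h3 : L * dist (‖y‖⁻¹ • y) d ≤ L * (2 * dist y d) :=
    mul_le_mul_of_nonneg_left (dist_inv_norm_smul_le hd y) hL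
  rw [hfd]
  linarith [dist_triangle (sphereExtend f y) (f (‖y‖⁻¹ • y)) (f d)]

/-! ### Bartle–Graves selection -/

/-- A bounded preimage of `y` still solves the equation approximately for nearby points, so a
partition of unity applies. Radial extension turns the absolute error on the sphere into a relative
one. -/
lemma exists_continuous_approx_rightInverse [CompleteSpace E] [CompleteSpace F] (T : E →L[ℝ] F)
    (hT : Function.Surjective T) :
    ∃ K : ℝ, 0 < K ∧ ∃ g : F → E, Continuous g ∧ (∀ y, ‖g y‖ ≤ K * ‖y‖) ∧
      ∀ y, ‖y - T (g y)‖ ≤ 1 / 2 * ‖y‖ := by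
  obtain ⟨C, hC, hpre⟩ := T.exists_preimage_norm_le hT
  obtain ⟨g, hg⟩ := exists_continuous_forall_mem_convex_of_local_const
    (t := fun y : F => T ⁻¹' Metric.ball y (1 / 2) ∩ Metric.ball 0 ((C + 1) * (‖y‖ + 1)))
    (fun y => ((convex_ball y _).linear_preimage T.toLinearMap).inter (convex_ball _ _))
    (fun y => by
      obtain ⟨x, hx, hxC⟩ := hpre y
      refine ⟨x, ?_⟩
      have h1 : ∀ᶠ z in 𝓝 y, dist (T x) z < 1 / 2 := by
        have : Continuous fun z => dist (T x) z := by fun_prop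
        exact this.tendsto y |>.eventually_lt_const (by simp [hx])
      have h2 : ∀ᶠ z in 𝓝 y, ‖x‖ < (C + 1) * (‖z‖ + 1) := by
        have : Continuous fun z : F => (C + 1) * (‖z‖ + 1) := by fun_prop
        exact this.tendsto y |>.eventually_const_lt (by nlinarith [norm_nonneg y])
      filter_upwards [h1, h2] with z hz1 hz2
      exact ⟨hz1, by simpa using hz2⟩)
  have hgK : ∀ y, ‖y‖ = 1 → ‖g y‖ ≤ (C + 1) * 2 := fun y hy => by
    have := (hg y).2
    rw [mem_ball_zero_iff, hy] at this
    linarith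
  refine ⟨(C + 1) * 2, by positivity, sphereExtend g, continuous_sphereExtend g.continuous hgK,
    norm_sphereExtend_le hgK, fun y => ?_⟩
  have h : y - T (sphereExtend g y) = sphereExtend (fun y => y - T (g y)) y := by
    rcases eq_or_ne y 0 with rfl | hy
    · simp [sphereExtend]
    · simp only [sphereExtend]
      rw [map_smul, smul_sub, smul_smul, mul_inv_cancel₀ (norm_ne_zero_iff.2 hy), one_smul]
  rw [h]
  refine norm_sphereExtend_le (fun z _ => ?_) y
  have := (hg z).1
  rw [Set.mem_preimage, Metric.mem_ball, dist_comm, dist_eq_norm] at this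
  exact this.le

/-- The Bartle–Graves theorem, with a linear bound. -/
theorem exists_continuous_rightInverse [CompleteSpace E] [CompleteSpace F] (T : E →L[ℝ] F)
    (hT : Function.Surjective T) :
    ∃ K : ℝ, 0 < K ∧ ∃ τ : F → E, Continuous τ ∧ (∀ y, T (τ y) = y) ∧ ∀ y, ‖τ y‖ ≤ K * ‖y‖ := by
  obtain ⟨K, hK, g, hgc, hgK, hgT⟩ := exists_continuous_approx_rightInverse T hT
  -- `R` is the residual of the approximate inverse. Applying `g` to the successive residuals and
  -- summing gives an exact one, since the images under `T` telescope.
  set R : F → F := fun y => y - T (g y) with hR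
  have hRc : Continuous R := by fun_prop
  have hRn : ∀ n y, ‖R^[n] y‖ ≤ (1 / 2) ^ n * ‖y‖ := by
    intro n y
    induction n with
    | zero => simp
    | succ n ih =>
      rw [Function.iterate_succ_apply', pow_succ']
      linarith [hgT (R^[n] y)]
  have hbound : ∀ n y, ‖g (R^[n] y)‖ ≤ K * ‖y‖ * (1 / 2) ^ n := fun n y => by
    have := mul_le_mul_of_nonneg_left (hRn n y) hK.le
    linarith [hgK (R^[n] y)]
  have hsum : ∀ y, Summable fun n => g (R^[n] y) := fun y =>
    .of_norm_bounded (summable_geometric_two.mul_left _) fun n => hbound n y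
  refine ⟨2 * K, by positivity, fun y => ∑' n, g (R^[n] y), ?_, fun y => ?_, fun y => ?_⟩
  · rw [continuous_iff_continuousAt]
    intro y
    have hon : ContinuousOn (fun y => ∑' n, g (R^[n] y)) (Metric.ball 0 (‖y‖ + 1)) := by
      refine continuousOn_tsum (u := fun n => K * (‖y‖ + 1) * (1 / 2) ^ n)
        (fun n => (hgc.comp (hRc.iterate n)).continuousOn) (summable_geometric_two.mul_left _)
        fun n z hz => (hbound n z).trans ?_
      have := (mem_ball_zero_iff.1 hz).le
      gcongr
    exact hon.continuousAt (Metric.isOpen_ball.mem_nhds (by simp))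
  · have htel : ∀ n, ∑ i ∈ Finset.range n, T (g (R^[i] y)) = y - R^[n] y := by
      intro n
      induction n with
      | zero => simp
      | succ n ih =>
        rw [Finset.sum_range_succ, ih, Function.iterate_succ_apply']
        simp only [hR]
        abel
    have h0 : Tendsto (fun n => R^[n] y) atTop (𝓝 0) := by
      refine squeeze_zero_norm (fun n => hRn n y) ?_
      simpa using (tendsto_pow_atTop_nhds_zero_of_lt_one (r := (1 / 2 : ℝ)) (by norm_num)
        (by norm_num)).mul_const ‖y‖
    have h1 := ((hsum y).hasSum.mapL T).tendsto_sum_nat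
    simp only [htel] at h1
    exact tendsto_nhds_unique h1 (by simpa using h0.const_sub y)
  · have h := tsum_of_norm_bounded (hasSum_geometric_two.mul_left (K * ‖y‖)) fun n => hbound n y
    linarith

/-! ### Gluing translates along separated sets -/

/-- Modify a right inverse `τ` near the points of a separated set so that near each of them it
becomes a translate of `τ₀`, moving it little, and less and less towards the closed set `A`. -/
lemma exists_rightInverse_eq_translate {T : E →L[ℝ] F} {K : ℝ} {τ₀ : F → E}
    (hτ₀ : Continuous τ₀) (hτ₀T : ∀ y, T (τ₀ y) = y) (hτ₀K : ∀ y, ‖τ₀ y‖ ≤ K * ‖y‖)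
    {A G : Set F} (hA : IsClosed A) {ε : ℝ} (hε : 0 < ε)
    (hG : G.Pairwise fun a b => ε ≤ dist a b) {δ : ℝ} (hδ : 0 < δ)
    {τ : F → E} (hτ : Continuous τ) (hτT : ∀ y, T (τ y) = y) :
    ∃ τ' : F → E, Continuous τ' ∧ (∀ y, T (τ' y) = y) ∧
      (∀ y, dist (τ y) (τ' y) ≤ δ) ∧ (∀ y, ∀ a ∈ A, dist (τ y) (τ' y) ≤ δ * dist y a) ∧
      ∀ d ∈ G \ A, ∀ᶠ y in 𝓝 d, τ' y = τ d + τ₀ (y - d) := by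
  have hτ₀0 : τ₀ 0 = 0 := norm_le_zero_iff.1 (by simpa using hτ₀K 0)
  have hr : ∀ d : ↥(G \ A), ∃ r : ℝ, 0 < r ∧ r ≤ ε / 4 ∧ ∀ y ∈ Metric.ball (d : F) r,
      ‖τ d + τ₀ (y - d) - τ y‖ ≤ δ ∧ ∀ a ∈ A, ‖τ d + τ₀ (y - d) - τ y‖ ≤ δ * dist y a := by
    intro d
    obtain ⟨ρ, hρ, hρA⟩ := Metric.isOpen_iff.1 hA.isOpen_compl d d.2.2
    have hc : Continuous fun y => ‖τ d + τ₀ (y - d) - τ y‖ := by fun_prop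
    -- The correction vanishes at `d`. Points within `ρ / 2` of `d` are at least `ρ / 2` away from
    -- `A`, so this one bound yields both estimates.
    have hev : ∀ᶠ y in 𝓝 (d : F), ‖τ d + τ₀ (y - d) - τ y‖ < δ * min 1 (ρ / 2) :=
      hc.tendsto d |>.eventually_lt_const (by simpa [hτ₀0] using by positivity)
    obtain ⟨r, hr, hrb⟩ := Metric.eventually_nhds_iff_ball.1 hev
    refine ⟨min r (min (ε / 4) (ρ / 2)), by positivity,
      (min_le_right _ _).trans (min_le_left _ _), fun y hy => ?_⟩
    have hyr := hrb y (Metric.ball_subset_ball (min_le_left _ _) hy)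
    have hyρ : dist y d < ρ / 2 :=
      hy.trans_le ((min_le_right _ _).trans (min_le_right _ _))
    refine ⟨hyr.le.trans ?_, fun a ha => hyr.le.trans ?_⟩
    · nlinarith [min_le_left 1 (ρ / 2)]
    · refine mul_le_mul_of_nonneg_left ((min_le_right _ _).trans ?_) hδ.le
      have : ρ ≤ dist a d := by
        by_contra! hlt
        exact hρA hlt ha
      linarith [dist_triangle_left a (d : F) y]
  choose r hr0 hrε hrb using hr
  set φ : ↥(G \ A) → F → ℝ := fun d y => max 0 (min 1 (2 - dist y d / (r d / 2))) with hφ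
  have hφc : ∀ d, Continuous (φ d) := fun d => by fun_prop
  have hφ0 : ∀ d y, 0 ≤ φ d y := fun d y => le_max_left _ _
  have hφ1 : ∀ d y, φ d y ≤ 1 := fun d y => max_le zero_le_one (min_le_left _ _)
  have hφball : ∀ d y, φ d y ≠ 0 → y ∈ Metric.ball (d : F) (r d) := fun d y h => by
    by_contra hy
    rw [Metric.mem_ball, not_lt] at hy
    refine h (max_eq_left ((min_le_right _ _).trans ?_))
    have := hr0 d
    rw [sub_nonpos, le_div_iff₀ (by positivity)]
    linarith
  have hφone : ∀ (d : ↥(G \ A)) (y : F), y ∈ Metric.ball (d : F) (r d / 2) → φ d y = 1 := by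
    intro d y h
    have := hr0 d
    have h1 : dist y d / (r d / 2) ≤ 1 := by
      rw [div_le_one (by positivity)]
      exact (Metric.mem_ball.1 h).le
    simp only [hφ]
    rw [min_eq_left (by linarith), max_eq_right zero_le_one]
  -- Radii at most `ε / 4` put both centres within `ε / 2` of `y`, contradicting separation.
  have huniq : ∀ (y : F) (d d' : ↥(G \ A)),
      (Metric.ball (d : F) (r d) ∩ Metric.ball y (ε / 4)).Nonempty →
      (Metric.ball (d' : F) (r d') ∩ Metric.ball y (ε / 4)).Nonempty → d = d' := by
    rintro y d d' ⟨z, hz, hzy⟩ ⟨z', hz', hzy'⟩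
    by_contra hne
    have h := hG d.2.1 d'.2.1 (fun h => hne (Subtype.ext h))
    rw [Metric.mem_ball] at hz hzy hz' hzy'
    have h1 := dist_triangle_left (d : F) y z
    have h2 := dist_triangle_left (d' : F) y z'
    have h3 := dist_triangle_right (d : F) d' y
    linarith [hrε d, hrε d']
  set h : ↥(G \ A) → F → E := fun d y => φ d y • (τ d + τ₀ (y - d) - τ y) with hh
  have hhc : ∀ d, Continuous (h d) := fun d => by
    have := hφc d
    fun_prop
  have hhball : ∀ d y, h d y ≠ 0 → y ∈ Metric.ball (d : F) (r d) := fun d y hne =>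
    hφball d y fun h0 => hne (by simp [hh, h0])
  have hlf : LocallyFinite fun d => Function.support (h d) := fun y => by
    refine ⟨Metric.ball y (ε / 4), Metric.ball_mem_nhds _ (by positivity), ?_⟩
    refine Set.Subsingleton.finite fun d hd d' hd' => huniq y d d' ?_ ?_
    · exact hd.mono (Set.inter_subset_inter_left _ fun z hz => hhball d z hz)
    · exact hd'.mono (Set.inter_subset_inter_left _ fun z hz => hhball d' z hz)
  have hval : ∀ (d : ↥(G \ A)) (y : F), y ∈ Metric.ball (d : F) (r d) →
      ∑ᶠ d', h d' y = h d y := fun d y hy => by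
    refine finsum_eq_single _ d fun d' hd' => ?_
    by_contra hne
    exact hd' (huniq y d' d ⟨y, hhball d' y hne, Metric.mem_ball_self (by positivity)⟩
      ⟨y, hy, Metric.mem_ball_self (by positivity)⟩)
  have hcases : ∀ y, (∑ᶠ d', h d' y = 0) ∨
      ∃ d : ↥(G \ A), y ∈ Metric.ball (d : F) (r d) ∧ ∑ᶠ d', h d' y = h d y := fun y => by
    by_cases hex : ∃ d : ↥(G \ A), y ∈ Metric.ball (d : F) (r d)
    · obtain ⟨d, hd⟩ := hex
      exact .inr ⟨d, hd, hval d y hd⟩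
    · push Not at hex
      refine .inl (finsum_eq_zero_of_forall_eq_zero fun d => ?_)
      by_contra hne
      exact hex d (hhball d y hne)
  have hhle : ∀ d y, ‖h d y‖ ≤ ‖τ d + τ₀ (y - d) - τ y‖ := fun d y => by
    simp only [hh]
    rw [norm_smul, Real.norm_of_nonneg (hφ0 d y)]
    exact mul_le_of_le_one_left (norm_nonneg _) (hφ1 d y)
  -- At each point at most one correction is nonzero, and `T` kills it as a multiple of a difference
  -- of two preimages of `y`.
  refine ⟨fun y => τ y + ∑ᶠ d, h d y, hτ.add (continuous_finsum hhc hlf), fun y => ?_,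
    fun y => ?_, fun y a ha => ?_, fun d hd => ?_⟩
  · rcases hcases y with h0 | ⟨d, -, h0⟩
    · simp [h0, hτT]
    · rw [map_add, h0]
      simp [hh, hτT, hτ₀T]
  · rw [dist_self_add_right]
    rcases hcases y with h0 | ⟨d, hd, h0⟩
    · simp [h0, hδ.le]
    · rw [h0]
      exact (hhle d y).trans (hrb d y hd).1
  · rw [dist_self_add_right]
    rcases hcases y with h0 | ⟨d, hd, h0⟩
    · rw [h0, norm_zero]
      positivity
    · rw [h0]
      exact (hhle d y).trans ((hrb d y hd).2 a ha)
  · filter_upwards [Metric.ball_mem_nhds d (half_pos (hr0 ⟨d, hd⟩))] with y hy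
    have hy' := Metric.ball_subset_ball (half_le_self (hr0 ⟨d, hd⟩).le) hy
    rw [hval ⟨d, hd⟩ y hy']
    simp only [hh]
    rw [hφone ⟨d, hd⟩ y hy, one_smul]
    abel

lemma exists_rightInverse_eventually_dist_le [CompleteSpace E] {T : E →L[ℝ] F} {K : ℝ}
    {τ₀ : F → E} (hτ₀ : Continuous τ₀) (hτ₀T : ∀ y, T (τ₀ y) = y) (hτ₀K : ∀ y, ‖τ₀ y‖ ≤ K * ‖y‖)
    {G : ℕ → Set F} {ε : ℕ → ℝ} (hε : ∀ n, 0 < ε n)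
    (hG : ∀ n, (G n).Pairwise fun a b => ε n ≤ dist a b) :
    ∃ τ : F → E, Continuous τ ∧ (∀ y, T (τ y) = y) ∧ (∀ y, dist (τ₀ y) (τ y) ≤ 1) ∧
      ∀ d ∈ ⋃ n, G n, ∀ᶠ y in 𝓝 d, dist (τ y) (τ d) ≤ (K + 1) * dist y d := by
  set A : ℕ → Set F := fun n => ⋃ k ∈ Finset.range n, G k with hAdef
  have hA : ∀ n, IsClosed (A n) := fun n =>
    isClosed_biUnion_finset fun k _ => Metric.isClosed_of_pairwise_le_dist (hε k) (hG k)
  have hAmono : Monotone A := fun m n hmn =>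
    Set.biUnion_subset_biUnion_left fun k hk =>
      Finset.mem_range.2 ((Finset.mem_range.1 hk).trans_le hmn)
  have hGA : ∀ n, G n ⊆ A (n + 1) := fun n =>
    Set.subset_biUnion_of_mem (u := G) (Finset.mem_coe.2 (Finset.self_mem_range_succ n))
  -- With this `δ`, all corrections from stage `n` on add up to at most `1 / 2 ^ n`.
  choose! next hnc hnT hn1 hnA hnG using fun (n : ℕ) (τ : F → E) (hτ : Continuous τ)
    (hτT : ∀ y, T (τ y) = y) => exists_rightInverse_eq_translate hτ₀ hτ₀T hτ₀K (hA n) (hε n)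
      (hG n) (δ := 1 / 2 / 2 ^ n) (by positivity) hτ hτT
  set σ : ℕ → F → E := fun n => Nat.rec τ₀ (fun n τ => next n τ) n with hσ
  have hσT : ∀ n, Continuous (σ n) ∧ ∀ y, T (σ n y) = y := by
    intro n
    induction n with
    | zero => exact ⟨hτ₀, hτ₀T⟩
    | succ n ih => exact ⟨hnc n _ ih.1 ih.2, hnT n _ ih.1 ih.2⟩
  have hσ1 : ∀ y n, dist (σ n y) (σ (n + 1) y) ≤ 1 / 2 / 2 ^ n := fun y n =>
    hn1 n _ (hσT n).1 (hσT n).2 y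
  have hσA : ∀ n y, ∀ a ∈ A n, dist (σ n y) (σ (n + 1) y) ≤ 1 / 2 / 2 ^ n * dist y a := fun n =>
    hnA n _ (hσT n).1 (hσT n).2
  have hσG : ∀ n, ∀ d ∈ G n \ A n, ∀ᶠ y in 𝓝 d, σ (n + 1) y = σ n d + τ₀ (y - d) := fun n =>
    hnG n _ (hσT n).1 (hσT n).2
  choose τ hτ using fun y => cauchySeq_tendsto_of_complete (cauchySeq_of_le_geometric_two (hσ1 y))
  have hunif : ∀ n y, dist (σ n y) (τ y) ≤ 1 / 2 ^ n := fun n y =>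
    dist_le_of_le_geometric_two_of_tendsto (hσ1 y) (hτ y) n
  -- Later corrections are dominated by a geometric series of sum `dist y a`; in particular they fix
  -- the points of `A n`.
  have hτA : ∀ n y, ∀ a ∈ A n, dist (σ n y) (τ y) ≤ dist y a := by
    intro n y a ha
    have := dist_le_of_le_geometric_two_of_tendsto₀ (f := fun m => σ (m + n) y) (C := dist y a)
      (fun m => ?_) ((tendsto_add_atTop_iff_nat n).2 (hτ y))
    · simpa using this
    · have h1 := hσA (m + n) y a (hAmono (Nat.le_add_left n m) ha)
      rw [show m + 1 + n = m + n + 1 by ring]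
      refine h1.trans ?_
      rw [div_div, div_div, div_mul_eq_mul_div, one_mul]
      have : (2 : ℝ) ^ m ≤ 2 ^ (m + n) := pow_le_pow_right₀ one_le_two (Nat.le_add_right m n)
      gcongr
  refine ⟨τ, ?_, fun y => ?_, fun y => by simpa [hσ] using hunif 0 y, fun d hd => ?_⟩
  · refine TendstoUniformly.continuous (F := σ) (p := atTop) ?_ (.of_forall fun n => (hσT n).1)
    rw [Metric.tendstoUniformly_iff]
    intro e he
    have h0 : Tendsto (fun n : ℕ => 1 / (2 : ℝ) ^ n) atTop (𝓝 0) := by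
      simpa [Function.comp_def] using tendsto_inv_atTop_zero.comp
        (tendsto_pow_atTop_atTop_of_one_lt (one_lt_two (α := ℝ)))
    filter_upwards [h0.eventually_lt_const he] with n hn y
    rw [dist_comm]
    exact (hunif n y).trans_lt hn
  · have h1 := (T.continuous.tendsto _).comp (hτ y)
    refine tendsto_nhds_unique h1 ?_
    simp only [Function.comp_def, (hσT _).2]
    exact tendsto_const_nhds
  -- At the first stage containing `d` the translate is installed, with constant `K`; all later
  -- stages together cost `1` more.
  · obtain ⟨n, hn, hmin⟩ : ∃ n, d ∈ G n ∧ d ∉ A n := by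
      classical
      have hex := Set.mem_iUnion.1 hd
      refine ⟨Nat.find hex, Nat.find_spec hex, fun h => ?_⟩
      obtain ⟨k, hk, hdk⟩ := Set.mem_iUnion₂.1 h
      exact Nat.find_min hex (Finset.mem_range.1 hk) hdk
    have hloc := hσG n d ⟨hn, hmin⟩
    have hd0 := hτA (n + 1) d d (hGA n hn)
    rw [dist_self] at hd0
    filter_upwards [hloc] with y hy
    have h1 := hτA (n + 1) y d (hGA n hn)
    have h2 : dist (σ (n + 1) y) (σ (n + 1) d) ≤ K * dist y d := by
      have hτ₀0 : τ₀ 0 = 0 := norm_le_zero_iff.1 (by simpa using hτ₀K 0)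
      rw [hy, hloc.self_of_nhds, sub_self, hτ₀0, dist_add_left, dist_zero_right, dist_eq_norm]
      exact hτ₀K _
    have h3 := dist_triangle4 (τ y) (σ (n + 1) y) (σ (n + 1) d) (τ d)
    rw [dist_comm (τ y) (σ (n + 1) y)] at h3
    linarith

end Real

/-! ### Separated nets and the pointwise Lipschitz condition -/

lemma exists_separated_net {M : Type*} [MetricSpace M] (s : Set M) {ε : ℝ} (hε : 0 < ε) :
    ∃ N ⊆ s, (N.Pairwise fun a b => ε ≤ dist a b) ∧ ∀ x ∈ s, ∃ a ∈ N, dist x a < ε := by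
  obtain ⟨N, hN⟩ := zorn_subset {N : Set M | N ⊆ s ∧ N.Pairwise fun a b => ε ≤ dist a b}
    (fun c hc hchain => ⟨⋃₀ c, ⟨Set.sUnion_subset fun t ht => (hc ht).1,
      (Set.pairwise_sUnion hchain.directedOn).2 fun t ht => (hc ht).2⟩,
      fun t ht => Set.subset_sUnion_of_mem ht⟩)
  refine ⟨N, hN.prop.1, hN.prop.2, fun x hx => ?_⟩
  by_contra! hfar
  -- A point far from `N` could be added to it, against maximality.
  have hxN : x ∈ N := hN.le_of_ge (y := insert x N)
    ⟨Set.insert_subset hx hN.prop.1, hN.prop.2.insert fun b hb _ =>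
      ⟨hfar b hb, dist_comm x b ▸ hfar b hb⟩⟩ (Set.subset_insert x N) (Set.mem_insert x N)
  exact absurd (hfar x hxN) (by simpa using hε)

lemma isNowhereDense_of_pairwise_le_dist {F : Type*} [NormedAddCommGroup F] [NormedSpace ℝ F]
    [Nontrivial F] {N : Set F} {ε : ℝ} (hε : 0 < ε) (hN : N.Pairwise fun a b => ε ≤ dist a b) :
    IsNowhereDense N := by
  rw [(Metric.isClosed_of_pairwise_le_dist hε hN).isNowhereDense_iff, Set.eq_empty_iff_forall_notMem]
  intro a ha
  have hacc : (𝓝[≠] a).NeBot := Module.punctured_nhds_neBot ℝ F a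
  have hev : ∀ᶠ b in 𝓝[≠] a, b ∈ interior N ∧ dist b a < ε ∧ b ≠ a :=
    inter_mem (nhdsWithin_le_nhds (isOpen_interior.mem_nhds ha))
      (inter_mem (nhdsWithin_le_nhds (Metric.ball_mem_nhds a hε)) self_mem_nhdsWithin)
  obtain ⟨b, hb, hba, hne⟩ := hev.exists
  exact absurd (hN (interior_subset hb) (interior_subset ha) hne) (not_le.2 hba)

lemma pointwiseLipschitzAt_of_eventually {M M' : Type*} [MetricSpace M] [MetricSpace M']
    {α : ℝ≥0} {f : M → M'} {b : M} (h : ∀ᶠ a in 𝓝 b, dist (f a) (f b) ≤ α * dist a b) :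
    PointwiseLipschitzAt α f b := by
  obtain ⟨ρ, hρ, hb⟩ := Metric.eventually_nhds_iff_ball.1 h
  refine limsup_le_of_le (by isBoundedDefault) ?_
  filter_upwards [Ioo_mem_nhdsGT hρ] with r hr
  have hr0 : ENNReal.ofReal r ≠ 0 := by simpa using hr.1
  have hsup : ⨆ a ∈ Metric.closedBall b r, edist (f b) (f a) ≤ α * ENNReal.ofReal r := by
    refine iSup₂_le fun a ha => ?_
    have h1 := hb a (Metric.closedBall_subset_ball hr.2 ha)
    rw [edist_comm, edist_dist, ← ENNReal.ofReal_coe_nnreal, ← ENNReal.ofReal_mul α.coe_nonneg]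
    exact ENNReal.ofReal_le_ofReal (h1.trans (mul_le_mul_of_nonneg_left ha α.2))
  calc _ ≤ (ENNReal.ofReal r)⁻¹ * (α * ENNReal.ofReal r) := mul_le_mul_right hsup _
    _ = α := by
      rw [mul_left_comm, ENNReal.inv_mul_cancel hr0 ENNReal.ofReal_ne_top, mul_one]

/-! ### Assembly over the reals, then over `𝕜` -/

theorem exists_homogeneous_rightInverse_pointwiseLipschitz {E F : Type*}
    [NormedAddCommGroup E] [NormedSpace ℝ E] [CompleteSpace E]
    [NormedAddCommGroup F] [NormedSpace ℝ F] [CompleteSpace F] [Nontrivial F]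
    (T : E →L[ℝ] F) (hT : Function.Surjective T) :
    ∃ η : ℝ≥0, 0 < η ∧ ∃ τ : F → E, (∀ t : ℝ, 0 ≤ t → ∀ y, τ (t • y) = t • τ y) ∧
      Continuous τ ∧ (∀ y, T (τ y) = y) ∧
      ∃ S : Set F, Dense S ∧ IsMeagre S ∧ PointwiseLipschitzOn η τ S := by
  obtain ⟨K, hK, τ₀, hτ₀, hτ₀T, hτ₀K⟩ := exists_continuous_rightInverse T hT
  have hε : ∀ n : ℕ, 0 < 1 / ((n : ℝ) + 1) := fun n => by positivity
  choose G hGs hG hGnet using fun n : ℕ => exists_separated_net (Metric.sphere (0 : F) 1) (hε n)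
  obtain ⟨τ, hτ, hτT, hτ1, hτL⟩ :=
    exists_rightInverse_eventually_dist_le hτ₀ hτ₀T hτ₀K hε hG
  have hτK : ∀ y, ‖y‖ = 1 → ‖τ y‖ ≤ K + 1 := fun y hy => by
    have h1 := hτ₀K y
    have h2 := hτ1 y
    rw [hy] at h1
    rw [dist_comm, dist_eq_norm] at h2
    linarith [norm_le_norm_add_norm_sub' (τ y) (τ₀ y)]
  have hS : (⋃ p : ℕ × {q : ℚ // 0 < q}, (fun d : F => ((p.2 : ℚ) : ℝ) • d) '' G p.1) =
      {y | ∃ (n : ℕ) (q : ℚ), 0 < q ∧ ∃ d ∈ G n, (q : ℝ) • d = y} := by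
    ext y
    simp
  -- The norm bound on the sphere and the pointwise constant at net points are both `K + 1`.
  refine ⟨⟨(K + 1) + 2 * (K + 1), by positivity⟩,
    NNReal.coe_pos.1 (show 0 < (K + 1) + 2 * (K + 1) by positivity), sphereExtend τ,
    fun t ht y => sphereExtend_smul τ ht y, continuous_sphereExtend hτ hτK,
    map_sphereExtend T hτT, _, ?_, isMeagre_iUnion (f := fun p : ℕ × {q : ℚ // 0 < q} =>
      (fun d : F => ((p.2 : ℚ) : ℝ) • d) '' G p.1) fun p => ?_, ?_⟩
  · rw [hS]
    have hne : Dense {y : F | y ≠ 0} := dense_compl_singleton 0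
    refine dense_closure.1 (hne.mono fun y (hy : y ≠ 0) => ?_)
    rw [Metric.mem_closure_iff]
    intro e he
    have hy0 : 0 < ‖y‖ := norm_pos_iff.2 hy
    obtain ⟨q, hq1, hq2⟩ := exists_rat_btwn (show ‖y‖ < ‖y‖ + e / 2 by linarith)
    have hq0 : (0 : ℝ) < q := hy0.trans hq1
    obtain ⟨n, hn⟩ := exists_nat_one_div_lt (show 0 < e / 2 / q by positivity)
    obtain ⟨d, hd, hdist⟩ := hGnet n (‖y‖⁻¹ • y) (by simpa using norm_inv_norm_smul_self hy)
    refine ⟨(q : ℝ) • d, ⟨n, q, by exact_mod_cast hq0, d, hd, rfl⟩, ?_⟩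
    have h1 : dist y ((q : ℝ) • ‖y‖⁻¹ • y) < e / 2 := by
      have h2 : y - (q : ℝ) • ‖y‖⁻¹ • y = (‖y‖ - q) • (‖y‖⁻¹ • y) := by
        rw [sub_smul, smul_inv_smul₀ hy0.ne']
      rw [dist_eq_norm, h2, norm_smul, norm_inv_norm_smul_self hy, mul_one, Real.norm_eq_abs,
        abs_lt]
      constructor <;> linarith
    have h3 : dist ((q : ℝ) • ‖y‖⁻¹ • y) ((q : ℝ) • d) < e / 2 := by
      rw [dist_smul₀, Real.norm_of_nonneg hq0.le, mul_comm, ← lt_div_iff₀ hq0]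
      exact hdist.trans hn
    linarith [dist_triangle y ((q : ℝ) • ‖y‖⁻¹ • y) ((q : ℝ) • d)]
  · have hq : (0 : ℝ) < (p.2 : ℚ) := by exact_mod_cast p.2.2
    refine (isNowhereDense_of_pairwise_le_dist (mul_pos hq (hε p.1)) ?_).isMeagre
    rintro _ ⟨a, ha, rfl⟩ _ ⟨b, hb, rfl⟩ hne
    have hab : a ≠ b := fun h => hne (by rw [h])
    simp only [dist_smul₀, Real.norm_of_nonneg hq.le]
    exact mul_le_mul_of_nonneg_left (hG p.1 ha hb hab) hq.le
  · rw [hS]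
    rintro _ ⟨n, q, hq, d, hd, rfl⟩
    have hq' : (0 : ℝ) < q := by exact_mod_cast hq
    have hd1 : ‖d‖ = 1 := by simpa using hGs n hd
    have hL := eventually_dist_sphereExtend_le (by positivity : 0 ≤ K + 1) hτK hd1
      (hτL d (Set.mem_iUnion.2 ⟨n, hd⟩))
    have hc : Tendsto (fun y : F => (q : ℝ)⁻¹ • y) (𝓝 ((q : ℝ) • d)) (𝓝 d) := by
      have : Continuous fun y : F => (q : ℝ)⁻¹ • y := by fun_prop
      simpa [smul_smul, inv_mul_cancel₀ hq'.ne'] using this.tendsto ((q : ℝ) • d)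
    refine pointwiseLipschitzAt_of_eventually ?_
    filter_upwards [hc.eventually hL] with y hy
    -- By homogeneity, scaling by `q` leaves the pointwise Lipschitz constant unchanged.
    obtain ⟨z, rfl⟩ : ∃ z, (q : ℝ) • z = y := ⟨(q : ℝ)⁻¹ • y, smul_inv_smul₀ hq'.ne' y⟩
    rw [inv_smul_smul₀ hq'.ne'] at hy
    rw [sphereExtend_smul τ hq'.le, sphereExtend_smul τ hq'.le, dist_smul₀, dist_smul₀,
      mul_left_comm]
    exact mul_le_mul_of_nonneg_left hy (norm_nonneg _)

theorem mainTheorem5 {𝕜 : Type*} [RCLike 𝕜] {X Y : Type*}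
    [NormedAddCommGroup X] [NormedSpace 𝕜 X] [CompleteSpace X]
    [NormedAddCommGroup Y] [NormedSpace 𝕜 Y] [CompleteSpace Y]
    (hX : ¬ FiniteDimensional 𝕜 X) (hY : ¬ FiniteDimensional 𝕜 Y)
    (T : X →L[𝕜] Y) (hT : Function.Surjective T) :
    ∃ η : ℝ≥0, 0 < η ∧ ∃ τ : Y → X,
      PositivelyHomogeneous 𝕜 τ ∧ Continuous τ ∧ (∀ y : Y, T (τ y) = y) ∧
      ∃ S : Set Y, Dense S ∧ IsMeagre S ∧ PointwiseLipschitzOn η τ S := by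
  let _ : NormedSpace ℝ X := NormedSpace.restrictScalars ℝ 𝕜 X
  let _ : NormedSpace ℝ Y := NormedSpace.restrictScalars ℝ 𝕜 Y
  have : IsScalarTower ℝ 𝕜 X := .restrictScalars ℝ 𝕜 X
  have : IsScalarTower ℝ 𝕜 Y := .restrictScalars ℝ 𝕜 Y
  -- In the zero space no dense set is meagre.
  have : Nontrivial Y := by
    by_contra h
    rw [not_nontrivial_iff_subsingleton] at h
    exact hY inferInstance
  obtain ⟨η, hη, τ, hhom, hτ⟩ :=
    exists_homogeneous_rightInverse_pointwiseLipschitz (T.restrictScalars ℝ) hT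
  refine ⟨η, hη, τ, fun t ht y => ?_, hτ⟩
  simpa only [RCLike.real_smul_eq_coe_smul (K := 𝕜)] using hhom t ht y
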